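/- Consider i.i.d. sources over the alphabet $\{1,2,3,\dots\}$. Let $\mathcal M$ be the set of all monotonic distributions $\theta=(\theta_1,\theta_2,\dots)$, i.e. $\theta_i\ge 0$, $\sum_i\theta_i=1$ and $\theta_1\ge\theta_2\ge\cdots$. All logarithms are to base $2$. A code is a sequence of binary prefix codes, one for each block length $n$, that encode blocks $x^n\in\{1,2,\dots\}^n$; its length function is denoted by $L$, and its average per-symbol redundancy for $\theta$ is $$R_n(L,\theta)=\frac1n E_\theta L(X^n)-H_\theta(X),\qquad H_\theta(X)=-\sum_i\theta_i\log\theta_i .$$ A code is universal for monotonic sources if $R_n(L,\theta)\to 0$ as $n\to\infty$ for every $\theta\in\mathcal M$ of finite entropy. **Corollary.** There is a single code, with length function $L^*$, that depends on no parameter of the source, is universal for monotonic sources, and has the following property. Let $\gamma>0$ and let $\theta\in\mathcal M$ be given by $$\theta_i=\frac{a}{i^{1+\gamma}},\quad i=1,2,\dots,$$ where $a>0$ is the normalizing constant for which $\sum_i\theta_i=1$. Then $H_\theta(X)<\infty$, and for every $\varepsilon>0$ there is $n_0=n_0(\gamma,\varepsilon)$ such that for all $n\ge n_0$ the expected length $E_\theta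 L^*(X^n)$ is finite and $$R_n(L^*,\theta)\le\begin{cases}(1+\varepsilon)\,\dfrac19\left(1+\dfrac1\gamma\right)\left(\dfrac2\gamma+\varepsilon-1\right)\dfrac{n^{1/3}(\log n)^2}{n}, & \gamma\le 2,\\[2ex](1+\varepsilon)\left(\dfrac{a\,\frac{3+\gamma}{1+\gamma}}{\gamma}+\dfrac{1-\frac{3}{1+\gamma}}{2}\right)\dfrac{n^{1/(1+\gamma)}\log n}{n}, & \gamma>2.\end{cases}$$ -/

import Mathlib

open Filter Topology

noncomputable section

/-- The class `M` of monotonic distributions over the positive integers: `θ i` is the probability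
of the letter `i`, the probabilities are non-negative, sum to `1`, and `θ 1 ≥ θ 2 ≥ ...`.
(Distributions over `{1, ..., k}` are those with `θ i = 0` for `i > k`.) -/
structure IsMonotonicSource (θ : ℕ+ → ℝ) : Prop where
  nonneg : ∀ i, 0 ≤ θ i
  hasSum_one : HasSum θ 1
  antitone : Antitone θ

/-- The probability `P_θ(x^n)` of a sequence of `n` letters drawn i.i.d. from `θ`. -/
def seqProb (θ : ℕ+ → ℝ) {n : ℕ} (x : Fin n → ℕ+) : ℝ := ∏ t, θ (x t)

/-- The terms `-θ i * log₂ (θ i)` of the entropy (with `0 log 0 = 0`). -/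
def entropyTerm (θ : ℕ+ → ℝ) (i : ℕ+) : ℝ := -(θ i * Real.logb 2 (θ i))

/-- The source has finite entropy. -/
def HasFiniteEntropy (θ : ℕ+ → ℝ) : Prop := Summable (entropyTerm θ)

/-- The per-symbol entropy `H_θ[X]` in bits. -/
def entropy (θ : ℕ+ → ℝ) : ℝ := ∑' i, entropyTerm θ i

/-- A binary prefix code for blocks of `n` letters: no codeword is a prefix of the codeword of a
different block. In particular the code is injective. -/
structure BlockCode (n : ℕ) where
  encode : (Fin n → ℕ+) → List Bool
  prefixFree : ∀ x y, encode x <+: encode y → x = y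

/-- The length function `L(x^n)` of a code, in bits. -/
def BlockCode.len {n : ℕ} (C : BlockCode n) (x : Fin n → ℕ+) : ℕ := (C.encode x).length

/-- The expected length `E_θ L[X^n]` is finite. -/
def BlockCode.HasFiniteExpectedLen {n : ℕ} (C : BlockCode n) (θ : ℕ+ → ℝ) : Prop :=
  Summable fun x : Fin n → ℕ+ => seqProb θ x * (C.len x : ℝ)

/-- The expected length `E_θ L[X^n]`. -/
def BlockCode.expectedLen {n : ℕ} (C : BlockCode n) (θ : ℕ+ → ℝ) : ℝ :=
  ∑' x : Fin n → ℕ+, seqProb θ x * (C.len x : ℝ)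

/-- The average per-symbol redundancy `R_n(L, θ) = E_θ L[X^n] / n - H_θ[X]`. -/
def BlockCode.redundancy {n : ℕ} (C : BlockCode n) (θ : ℕ+ → ℝ) : ℝ :=
  C.expectedLen θ / n - entropy θ

/-- A code (one block code for each length `n`, chosen without knowledge of the source) is universal
for monotonic sources if its per-symbol redundancy vanishes, as `n → ∞`, for every monotonic source
of finite entropy. -/
def IsUniversalMonotonicCode (C : ∀ n, BlockCode n) : Prop :=
  ∀ θ : ℕ+ → ℝ, IsMonotonicSource θ → HasFiniteEntropy θ →
    (∀ᶠ n in atTop, (C n).HasFiniteExpectedLen θ) ∧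
      Tendsto (fun n => (C n).redundancy θ) atTop (𝓝 0)

end

/-! The code is a two-part code: name a member of a countable family of memoryless sources, then use
the ideal code of that member, keeping the shortest description. The cost over the ideal code is
`-log` of the weight of the member plus `O(1)` (`exists_prefixCode`, `exists_twoPartCode`).

Power laws with exponents on a grid of step `1/(n+1)` give the rate. Rounding `γ` up to the grid
costs `O(1)` bits per block and naming the grid point about `2 log n`, so the redundancy is `O(log
n)/n` (`powerLaw_redundancy_le`). Both claimed bounds carry an extra positive power of `n` with a
positive coefficient, hence dominate it eventually.

Smoothed empirical distributions give universality. Monotonicity and finite entropy make `E log i`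
finite, so these sources come arbitrarily close to `θ` in relative entropy
(`exists_smoothedEmpirical`), at an overhead independent of `n`. Kraft's inequality keeps the
redundancy nonnegative (`mul_entropy_le`). -/

/-! ### Prefix codes from cumulative probabilities -/

/-- The `l`-bit big-endian binary expansion of `m`. -/
def natBits (m l : ℕ) : List Bool := List.ofFn fun t : Fin l => m.testBit (l - 1 - t)

theorem length_natBits (m l : ℕ) : (natBits m l).length = l := by simp [natBits]

/-- In big-endian order, truncating a word drops low bits, which is division by a power of two. -/
theorem natBits_prefix {m l m' l' : ℕ} (hm : m < 2 ^ l) (hm' : m' < 2 ^ l')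
    (h : natBits m l <+: natBits m' l') : l ≤ l' ∧ m' / 2 ^ (l' - l) = m := by
  have hl : l ≤ l' := by simpa [length_natBits] using h.length_le
  refine ⟨hl, Nat.eq_of_testBit_eq fun i => ?_⟩
  rw [Nat.testBit_div_two_pow]
  by_cases hi : i < l
  · have h1 := h.getElem (i := l - 1 - i) (by simp only [length_natBits]; omega)
    simp only [natBits, List.getElem_ofFn] at h1
    rw [show l - 1 - (l - 1 - i) = i by omega,
      show l' - 1 - (l - 1 - i) = i + (l' - l) by omega] at h1
    exact h1.symm
  · rw [Nat.testBit_lt_two_pow (hm'.trans_le (Nat.pow_le_pow_right two_pos (by omega))),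
      Nat.testBit_lt_two_pow (hm.trans_le (Nat.pow_le_pow_right two_pos (by omega)))]

/-- Shannon–Fano–Elias coding: a positive sub-probability on a countable alphabet has a binary
prefix code whose lengths exceed the ideal ones by at most two bits. -/
theorem exists_prefixCode {X : Type*} [Countable X] (p : X → ℝ) (hp : ∀ x, 0 < p x)
    (hs : Summable p) (h1 : ∑' x, p x ≤ 1) :
    ∃ e : X → List Bool, (∀ x y, e x <+: e y → x = y) ∧
      (∀ x, ((e x).length : ℝ) ≤ -Real.logb 2 (p x) + 2) ∧
      ∀ x, -Real.logb 2 (p x) ≤ (e x).length := by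
  classical
  obtain ⟨enc, henc⟩ := exists_injective_nat X
  set F : X → ℝ := fun x => ∑' y, if enc y < enc x then p y else 0
  have hind : ∀ (c : Prop) [Decidable c] y, 0 ≤ (if c then p y else 0) ∧
      (if c then p y else 0) ≤ p y := fun c _ y => by
    split_ifs
    exacts [⟨(hp y).le, le_rfl⟩, ⟨le_rfl, (hp y).le⟩]
  have hsum : ∀ (q : X → Prop) [DecidablePred q], Summable fun y => if q y then p y else 0 :=
    fun q _ => hs.of_nonneg_of_le (fun y => (hind _ y).1) fun y => (hind _ y).2
  have hFp : ∀ x, F x + p x = ∑' y, if enc y ≤ enc x then p y else 0 := fun x => by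
    rw [show p x = ∑' y, if y = x then p y else 0 by simp [tsum_ite_eq],
      ← (hsum fun y => enc y < enc x).tsum_add (hsum fun y => y = x)]
    refine tsum_congr fun y => ?_
    rcases lt_trichotomy (enc y) (enc x) with h | h | h
    · have : y ≠ x := by rintro rfl; exact lt_irrefl _ h
      simp [h, h.le, this]
    · simp [henc h]
    · have : y ≠ x := by rintro rfl; exact lt_irrefl _ h
      simp [h.not_gt, h.not_ge, this]
  have hF0 : ∀ x, 0 ≤ F x := fun x => tsum_nonneg fun y => (hind _ y).1
  have hF1 : ∀ x, F x + p x ≤ 1 := fun x => by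
    rw [hFp]
    exact ((hsum fun y => enc y ≤ enc x).tsum_le_tsum (fun y => (hind _ y).2) hs).trans h1
  have hFlt : ∀ x y, enc x < enc y → F x + p x ≤ F y := fun x y hxy => by
    rw [hFp]
    refine (hsum fun z => enc z ≤ enc x).tsum_le_tsum (fun z => ?_) (hsum fun z => enc z < enc y)
    by_cases hz : enc z ≤ enc x
    · simp [hz, hz.trans_lt hxy]
    · rw [if_neg hz]; exact (hind _ z).1
  have hple : ∀ x, p x ≤ 1 := fun x => by linarith [hF0 x, hF1 x]
  have hlog : ∀ x, 0 ≤ -Real.logb 2 (p x) := fun x => by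
    linarith [Real.logb_nonpos one_lt_two (hp x).le (hple x)]
  -- The extra bit makes `[F x, F x + p x)` at least two dyadic cells of width `2 ^ (-l x)` long, so
  -- it contains the whole cell starting at `m x / 2 ^ l x`.
  set l : X → ℕ := fun x => ⌈-Real.logb 2 (p x)⌉₊ + 1
  set m : X → ℕ := fun x => ⌈F x * 2 ^ l x⌉₊
  have hpl : ∀ x, 2 ≤ p x * 2 ^ l x := fun x => by
    have h2 : (p x)⁻¹ ≤ 2 ^ ⌈-Real.logb 2 (p x)⌉₊ := by
      rw [← Real.rpow_natCast, ← Real.logb_le_iff_le_rpow one_lt_two (inv_pos.2 (hp x)),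
        Real.logb_inv]
      exact Nat.le_ceil _
    have h3 := mul_le_mul_of_nonneg_left h2 (hp x).le
    rw [mul_inv_cancel₀ (hp x).ne'] at h3
    simp only [l, pow_succ]; linarith
  have hm0 : ∀ x, F x * 2 ^ l x ≤ m x := fun x => Nat.le_ceil _
  have hm1 : ∀ x, (m x : ℝ) + 1 ≤ (F x + p x) * 2 ^ l x := fun x => by
    have := Nat.ceil_lt_add_one (mul_nonneg (hF0 x) (by positivity : (0:ℝ) ≤ 2 ^ l x))
    have := hpl x
    simp only [m]; linarith
  have hm2 : ∀ x, m x < 2 ^ l x := fun x => by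
    have h2 : (F x + p x) * 2 ^ l x ≤ 1 * 2 ^ l x :=
      mul_le_mul_of_nonneg_right (hF1 x) (by positivity)
    have h3 : (m x : ℝ) < 2 ^ l x := by linarith [hm1 x]
    exact_mod_cast h3
  refine ⟨fun x => natBits (m x) (l x), fun x y hxy => ?_, fun x => ?_, fun x => ?_⟩
  -- A prefix relation nests the cell of `y` in that of `x`, so the left end of the former lies in
  -- the intervals of both symbols; distinct symbols have disjoint intervals.
  · obtain ⟨hl, hd⟩ := natBits_prefix (hm2 x) (hm2 y) hxy
    have hpow : (2 : ℝ) ^ l y = 2 ^ l x * 2 ^ (l y - l x) := by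
      rw [← pow_add, Nat.add_sub_cancel' hl]
    have ha : (m x : ℝ) * 2 ^ (l y - l x) ≤ m y := by
      exact_mod_cast hd ▸ Nat.div_mul_le_self (m y) (2 ^ (l y - l x))
    have hb : (m y : ℝ) < (m x + 1) * 2 ^ (l y - l x) := by
      have := Nat.lt_mul_div_succ (m y) (pow_pos two_pos (l y - l x))
      rw [hd, mul_comm] at this
      exact_mod_cast this
    have hx0 : F x * 2 ^ l y ≤ m y := by
      refine le_trans ?_ ha
      rw [hpow, ← mul_assoc]
      exact mul_le_mul_of_nonneg_right (hm0 x) (by positivity)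
    have hx1 : (m y : ℝ) < (F x + p x) * 2 ^ l y := by
      refine hb.trans_le ?_
      rw [hpow, ← mul_assoc]
      exact mul_le_mul_of_nonneg_right (hm1 x) (by positivity)
    have hy0 := hm0 y
    have hy1 := hm1 y
    have hpos : (0 : ℝ) < 2 ^ l y := by positivity
    rcases lt_trichotomy (enc x) (enc y) with h | h | h
    · have := mul_le_mul_of_nonneg_right (hFlt x y h) hpos.le
      linarith
    · exact henc h
    · have := mul_le_mul_of_nonneg_right (hFlt y x h) hpos.le
      linarith
  · rw [length_natBits]
    have := Nat.ceil_lt_add_one (hlog x)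
    simp only [l]; push_cast; linarith
  · rw [length_natBits]
    have := Nat.le_ceil (-Real.logb 2 (p x))
    simp only [l]; push_cast; linarith

/-! ### Expectations over i.i.d. blocks and the entropy lower bound -/

theorem hasSum_prod_fin {α : Type*} {n : ℕ} {f : Fin n → α → ℝ} {s : Fin n → ℝ}
    (h0 : ∀ t i, 0 ≤ f t i) (hs : ∀ t, HasSum (f t) (s t)) :
    HasSum (fun x : Fin n → α => ∏ t, f t (x t)) (∏ t, s t) := by
  induction n with
  | zero => simp
  | succ n ih =>
    set g : (Fin n → α) → ℝ := fun x => ∏ t, f t.succ (x t) with hgdef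
    have hg : HasSum g (∏ t : Fin n, s t.succ) := ih (fun t => h0 _) fun t => hs t.succ
    have hg0 : 0 ≤ g := fun x => Finset.prod_nonneg fun t _ => h0 _ _
    have hm : Summable fun z : α × (Fin n → α) => f 0 z.1 * g z.2 :=
      Summable.mul_of_nonneg (hs 0).summable hg.summable (fun i => h0 0 i) hg0
    have h := HasSum.mul (hs 0) hg hm
    rw [Fin.prod_univ_succ, ← (Fin.consEquiv fun _ => α).hasSum_iff]
    have he : (fun x : Fin (n + 1) → α => ∏ t, f t (x t)) ∘ (Fin.consEquiv fun _ => α) =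
        fun z : α × (Fin n → α) => f 0 z.1 * g z.2 := by
      funext z
      simp [Fin.consEquiv, Fin.prod_univ_succ, hgdef]
    rw [he]
    exact h

theorem IsMonotonicSource.le_one {θ : ℕ+ → ℝ} (hθ : IsMonotonicSource θ) (i : ℕ+) : θ i ≤ 1 :=
  le_hasSum hθ.hasSum_one i fun j _ => hθ.nonneg j

theorem IsMonotonicSource.neg_logb_nonneg {θ : ℕ+ → ℝ} (hθ : IsMonotonicSource θ) (i : ℕ+) :
    0 ≤ -Real.logb 2 (θ i) :=
  neg_nonneg.2 (Real.logb_nonpos one_lt_two (hθ.nonneg i) (hθ.le_one i))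

/-- The first `i` letters each have probability at least `θ i`. -/
theorem IsMonotonicSource.mul_le_one {θ : ℕ+ → ℝ} (hθ : IsMonotonicSource θ) (i : ℕ+) :
    (i : ℕ) * θ i ≤ 1 := by
  have h := sum_le_hasSum (Finset.Icc 1 i) (fun j _ => hθ.nonneg j) hθ.hasSum_one
  refine le_trans ?_ h
  have h2 := Finset.card_nsmul_le_sum (Finset.Icc 1 i) θ (θ i)
    fun j hj => hθ.antitone (Finset.mem_Icc.1 hj).2
  simpa using h2

theorem IsMonotonicSource.mul_logb_le_entropyTerm {θ : ℕ+ → ℝ} (hθ : IsMonotonicSource θ)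
    (i : ℕ+) : θ i * Real.logb 2 (i : ℕ) ≤ entropyTerm θ i := by
  have hi : (0 : ℝ) < (i : ℕ) := by exact_mod_cast i.pos
  rw [entropyTerm, ← mul_neg]
  rcases (hθ.nonneg i).eq_or_lt with h | h
  · simp [← h]
  · refine mul_le_mul_of_nonneg_left ?_ h.le
    rw [← Real.logb_inv]
    refine Real.logb_le_logb_of_le one_lt_two hi ?_
    rw [← one_div, le_div_iff₀ h]
    exact hθ.mul_le_one i

/-- This is where monotonicity enters universality: one fixed distribution with a polynomial tail
has finite cross-entropy against every such source. -/
theorem IsMonotonicSource.summable_mul_logb {θ : ℕ+ → ℝ} (hθ : IsMonotonicSource θ)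
    (hH : HasFiniteEntropy θ) : Summable fun i : ℕ+ => θ i * Real.logb 2 (i : ℕ) :=
  Summable.of_nonneg_of_le (fun i => mul_nonneg (hθ.nonneg i)
      (Real.logb_nonneg one_lt_two (by exact_mod_cast i.pos)))
    hθ.mul_logb_le_entropyTerm hH

theorem IsMonotonicSource.seqProb_nonneg {θ : ℕ+ → ℝ} (hθ : IsMonotonicSource θ) {n : ℕ}
    (x : Fin n → ℕ+) : 0 ≤ seqProb θ x :=
  Finset.prod_nonneg fun _ _ => hθ.nonneg _

theorem IsMonotonicSource.hasSum_seqProb {θ : ℕ+ → ℝ} (hθ : IsMonotonicSource θ) (n : ℕ) :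
    HasSum (fun x : Fin n → ℕ+ => seqProb θ x) 1 := by
  simpa [seqProb] using hasSum_prod_fin (n := n) (f := fun _ => θ) (fun _ => hθ.nonneg)
    fun _ => hθ.hasSum_one

/-- The expectation of an additive function of a block of `n` i.i.d. letters. -/
theorem IsMonotonicSource.hasSum_seqProb_mul_sum {θ g : ℕ+ → ℝ} {s : ℝ}
    (hθ : IsMonotonicSource θ) (hg : ∀ i, 0 ≤ g i) (hs : HasSum (fun i => θ i * g i) s) (n : ℕ) :
    HasSum (fun x : Fin n → ℕ+ => seqProb θ x * ∑ t, g (x t)) (n * s) := by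
  have key : ∀ t : Fin n, HasSum (fun x : Fin n → ℕ+ => seqProb θ x * g (x t)) s := fun t => by
    -- The expectation of `g (x t)` is a product in which only factor `t` carries `g`.
    have h := hasSum_prod_fin (n := n) (f := fun r i => θ i * if r = t then g i else 1)
      (s := fun r => if r = t then s else 1)
      (fun r i => mul_nonneg (hθ.nonneg i) (by split_ifs; exacts [hg i, zero_le_one]))
      (fun r => by
        by_cases hr : r = t
        · simpa [hr] using hs
        · simpa [hr] using hθ.hasSum_one)
    simpa only [Finset.prod_mul_distrib, Finset.prod_ite_eq', Finset.mem_univ, if_true, seqProb]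
      using h
  have h := hasSum_sum (s := Finset.univ) fun t _ => key t
  simpa [Finset.mul_sum] using h

/-- The converse source coding theorem for lengths satisfying Kraft's inequality. -/
theorem IsMonotonicSource.mul_entropy_le {θ : ℕ+ → ℝ} (hθ : IsMonotonicSource θ)
    (hH : HasFiniteEntropy θ) {n : ℕ} (l : (Fin n → ℕ+) → ℕ)
    (hk : Summable fun x => ((2 : ℝ) ^ l x)⁻¹) (hk1 : ∑' x, ((2 : ℝ) ^ l x)⁻¹ ≤ 1)
    (hl : Summable fun x => seqProb θ x * (l x : ℝ)) :
    n * entropy θ ≤ ∑' x, seqProb θ x * (l x : ℝ) := by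
  have hE : HasSum (fun x : Fin n → ℕ+ => seqProb θ x * ∑ t, -Real.logb 2 (θ (x t)))
      (n * entropy θ) := by
    refine hθ.hasSum_seqProb_mul_sum hθ.neg_logb_nonneg ?_ n
    simp only [mul_neg]
    exact Summable.hasSum hH
  have hlog2 : 0 < Real.log 2 := Real.log_pos one_lt_two
  -- Gibbs' inequality: `log u ≤ u - 1` at `u = 2 ^ (-l x) / seqProb θ x` bounds the terms
  -- pointwise, and by Kraft the correction added here has nonpositive sum.
  have hR := hl.hasSum.add ((hk.hasSum.sub (hθ.hasSum_seqProb n)).div_const (Real.log 2))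
  have hle := hasSum_le (fun x => ?_) hE hR
  · have : (∑' x, ((2 : ℝ) ^ l x)⁻¹ - 1) / Real.log 2 ≤ 0 :=
      div_nonpos_of_nonpos_of_nonneg (by linarith) hlog2.le
    linarith
  · rcases (hθ.seqProb_nonneg x).eq_or_lt with h | h
    · simp only [← h, zero_mul, sub_zero, zero_add]
      positivity
    · have hne : ∀ t, θ (x t) ≠ 0 := fun t ht =>
        h.ne' (Finset.prod_eq_zero (Finset.mem_univ t) ht)
      have h1 : ∑ t, -Real.logb 2 (θ (x t)) = -(Real.log (seqProb θ x) / Real.log 2) := by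
        rw [seqProb, Real.log_prod fun t _ => hne t, Finset.sum_div, ← Finset.sum_neg_distrib]
        rfl
      have h2 := Real.log_le_sub_one_of_pos
        (div_pos (inv_pos.2 (pow_pos two_pos (l x) : (0 : ℝ) < 2 ^ l x)) h)
      rw [Real.log_div (by positivity) h.ne', Real.log_inv, Real.log_pow] at h2
      have h3 := mul_le_mul_of_nonneg_left h2 h.le
      have h4 : seqProb θ x * (((2 : ℝ) ^ l x)⁻¹ / seqProb θ x - 1)
          = ((2 : ℝ) ^ l x)⁻¹ - seqProb θ x := by field_simp
      rw [h4] at h3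
      rw [h1, ← sub_le_iff_le_add', le_div_iff₀ hlog2]
      refine le_trans (le_of_eq ?_) h3
      field_simp
      ring

/-! ### Two-part codes and their redundancy -/

/-- The two-part code for a countable family of memoryless sources `q j` with weights `w j`. -/
theorem exists_twoPartCode {J : Type*} [Countable J] [Nonempty J] (n : ℕ) (w : J → ℝ)
    (q : J → ℕ+ → ℝ) (hw : ∀ j, 0 < w j) (hws : Summable w) (hw1 : ∑' j, w j ≤ 1)
    (hq : ∀ j i, 0 < q j i) (hqs : ∀ j, HasSum (q j) 1) :
    ∃ C : BlockCode n,
      (∀ j x, (C.len x : ℝ) ≤ -Real.logb 2 (w j) + ∑ t, -Real.logb 2 (q j (x t)) + 2) ∧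
      (Summable fun x => ((2 : ℝ) ^ C.len x)⁻¹) ∧ ∑' x, ((2 : ℝ) ^ C.len x)⁻¹ ≤ 1 := by
  set p : J × (Fin n → ℕ+) → ℝ := fun z => w z.1 * ∏ t, q z.1 (z.2 t)
  have hp : ∀ z, 0 < p z := fun z => mul_pos (hw _) (Finset.prod_pos fun t _ => hq _ _)
  have hfib : ∀ j, HasSum (fun x => p (j, x)) (w j) := fun j => by
    simpa using (hasSum_prod_fin (n := n) (f := fun _ => q j) (fun _ i => (hq j i).le)
      fun _ => hqs j).mul_left (w j)
  have hps : Summable p := by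
    rw [summable_prod_of_nonneg fun z => (hp z).le]
    exact ⟨fun j => (hfib j).summable, by simpa only [(hfib _).tsum_eq] using hws⟩
  have hp1 : ∑' z, p z ≤ 1 := by
    rw [hps.tsum_prod' fun j => (hfib j).summable]
    simpa only [(hfib _).tsum_eq] using hw1
  obtain ⟨e, he, hlen, hlen'⟩ := exists_prefixCode p hp hps hp1
  have hmin : ∀ x : Fin n → ℕ+, ∃ j, ∀ j', (e (j, x)).length ≤ (e (j', x)).length := fun x =>
    ⟨Function.argmin fun j => (e (j, x)).length,
      fun j => Function.argmin_le (fun j => (e (j, x)).length) j⟩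
  choose b hb using hmin
  -- The lower bound on codeword lengths gives Kraft's inequality directly from the total mass of
  -- `p`.
  have hle : ∀ x, ((2 : ℝ) ^ (e (b x, x)).length)⁻¹ ≤ p (b x, x) := fun x => by
    have h := hlen' (b x, x)
    rw [← Real.logb_inv, Real.logb_le_iff_le_rpow one_lt_two (inv_pos.2 (hp _)),
      Real.rpow_natCast] at h
    exact inv_le_of_inv_le₀ (hp _) h
  have hinj : Function.Injective fun x => (b x, x) := fun x y h => (Prod.ext_iff.1 h).2
  have hpb : Summable fun x => p (b x, x) := hps.comp_injective hinj
  have hks : Summable fun x => ((2 : ℝ) ^ (e (b x, x)).length)⁻¹ :=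
    hpb.of_nonneg_of_le (fun x => by positivity) hle
  refine ⟨⟨fun x => e (b x, x), fun x y h => (Prod.ext_iff.1 (he _ _ h)).2⟩, fun j x => ?_, hks,
    (hks.tsum_le_tsum hle hpb).trans ((tsum_comp_le_tsum_of_inj hps (fun z => (hp z).le)
      hinj).trans hp1)⟩
  have h1 : ((e (b x, x)).length : ℝ) ≤ (e (j, x)).length := by exact_mod_cast hb x j
  have h2 := hlen (j, x)
  rw [Real.logb_mul (hw j).ne' (Finset.prod_pos fun t _ => hq j _).ne',
    Real.logb_prod _ _ fun t _ => (hq j _).ne'] at h2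
  rw [Finset.sum_neg_distrib]
  simp only [BlockCode.len]
  linarith

/-- The redundancy of a code that is nearly as short as the ideal code of a memoryless source. -/
theorem IsMonotonicSource.redundancy_le {θ q : ℕ+ → ℝ} (hθ : IsMonotonicSource θ) {n : ℕ}
    (hn : 0 < n) (C : BlockCode n) {k s : ℝ} (hq0 : ∀ i, 0 ≤ -Real.logb 2 (q i))
    (hC : ∀ x, (C.len x : ℝ) ≤ k + ∑ t, -Real.logb 2 (q (x t)))
    (hs : HasSum (fun i => θ i * -Real.logb 2 (q i)) s) :
    C.HasFiniteExpectedLen θ ∧ C.redundancy θ ≤ k / n + (s - entropy θ) := by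
  have hR := ((hθ.hasSum_seqProb n).mul_right k).add (hθ.hasSum_seqProb_mul_sum hq0 hs n)
  have hle : ∀ x, seqProb θ x * (C.len x : ℝ) ≤
      seqProb θ x * k + seqProb θ x * ∑ t, -Real.logb 2 (q (x t)) := fun x => by
    rw [← mul_add]
    exact mul_le_mul_of_nonneg_left (hC x) (hθ.seqProb_nonneg x)
  have hfin : C.HasFiniteExpectedLen θ := hR.summable.of_nonneg_of_le
    (fun x => mul_nonneg (hθ.seqProb_nonneg x) (Nat.cast_nonneg _)) hle
  refine ⟨hfin, ?_⟩
  have h := hasSum_le hle hfin.hasSum hR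
  have hn' : (0 : ℝ) < n := by exact_mod_cast hn
  have : C.expectedLen θ / n ≤ k / n + s := by
    rw [div_le_iff₀ hn', add_mul, div_mul_cancel₀ _ hn'.ne', BlockCode.expectedLen]
    linarith
  rw [BlockCode.redundancy]
  linarith

/-! ### Approximation by smoothed empirical distributions -/

/-- The probability distribution `1 / (i (i + 1))` on the positive integers. -/
noncomputable def telescopingWeight (i : ℕ+) : ℝ := 1 / ((i : ℕ) * ((i : ℕ) + 1))

theorem telescopingWeight_pos (i : ℕ+) : 0 < telescopingWeight i := by
  have : (0 : ℝ) < (i : ℕ) := by exact_mod_cast i.pos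
  unfold telescopingWeight; positivity

theorem hasSum_telescopingWeight : HasSum telescopingWeight 1 := by
  rw [← Equiv.pnatEquivNat.symm.hasSum_iff,
    hasSum_iff_tendsto_nat_of_nonneg (f := telescopingWeight ∘ Equiv.pnatEquivNat.symm)
      fun i => (telescopingWeight_pos _).le]
  have h : ∀ n : ℕ, ∑ i ∈ Finset.range n, (telescopingWeight ∘ Equiv.pnatEquivNat.symm) i
      = 1 - 1 / ((n : ℝ) + 1) := fun n => by
    induction n with
    | zero => simp
    | succ n ih =>
      rw [Finset.sum_range_succ, ih]
      simp only [telescopingWeight, Function.comp, Equiv.pnatEquivNat_symm_apply,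
        Nat.succPNat_coe, Nat.succ_eq_add_one]
      push_cast
      field_simp
      ring
  simp only [h]
  simpa using tendsto_const_nhds.sub (tendsto_one_div_add_atTop_nhds_zero_nat (𝕜 := ℝ))

theorem neg_logb_telescopingWeight_le (i : ℕ+) :
    -Real.logb 2 (telescopingWeight i) ≤ 1 + 2 * Real.logb 2 (i : ℕ) := by
  have hi : (1 : ℝ) ≤ (i : ℕ) := by exact_mod_cast i.pos
  have h0 : (0 : ℝ) < (i : ℕ) := by linarith
  rw [telescopingWeight, one_div, Real.logb_inv, neg_neg, Real.logb_mul h0.ne' (by positivity)]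
  have h : Real.logb 2 ((i : ℕ) + 1) ≤ Real.logb 2 (2 * (i : ℕ)) :=
    Real.logb_le_logb_of_le one_lt_two (by positivity) (by linarith)
  rw [Real.logb_mul two_ne_zero h0.ne', Real.logb_self_eq_one one_lt_two] at h
  linarith

/-- The empirical distribution of the counts `f`, smoothed by `M` virtual observations distributed
as `telescopingWeight`. -/
noncomputable def smoothedEmpirical (d : (ℕ+ →₀ ℕ) × ℕ+) (i : ℕ+) : ℝ :=
  ((d.1 i : ℝ) + (d.2 : ℕ) * telescopingWeight i) / ((d.1.sum fun _ c => (c : ℝ)) + (d.2 : ℕ))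

theorem smoothedEmpirical_denom_pos (d : (ℕ+ →₀ ℕ) × ℕ+) :
    0 < (d.1.sum fun _ c => (c : ℝ)) + (d.2 : ℕ) := by
  have h1 : (0 : ℝ) < (d.2 : ℕ) := by exact_mod_cast d.2.pos
  have h2 : 0 ≤ d.1.sum fun _ c => (c : ℝ) := Finset.sum_nonneg fun _ _ => Nat.cast_nonneg _
  linarith

theorem smoothedEmpirical_pos (d : (ℕ+ →₀ ℕ) × ℕ+) (i : ℕ+) : 0 < smoothedEmpirical d i := by
  have h1 : (0 : ℝ) < (d.2 : ℕ) := by exact_mod_cast d.2.pos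
  have h2 := mul_pos h1 (telescopingWeight_pos i)
  exact div_pos (by positivity) (smoothedEmpirical_denom_pos d)

theorem hasSum_smoothedEmpirical (d : (ℕ+ →₀ ℕ) × ℕ+) : HasSum (smoothedEmpirical d) 1 := by
  have h1 : HasSum (fun i => (d.1 i : ℝ)) (d.1.sum fun _ c => (c : ℝ)) :=
    hasSum_sum_of_ne_finset_zero fun i hi => by simpa using hi
  have h := (h1.add (hasSum_telescopingWeight.mul_left ((d.2 : ℕ) : ℝ))).div_const
    ((d.1.sum fun _ c => (c : ℝ)) + (d.2 : ℕ))
  rwa [mul_one, div_self (smoothedEmpirical_denom_pos d).ne'] at h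

theorem neg_logb_nonneg_of_hasSum_one {q : ℕ+ → ℝ} (hq : ∀ i, 0 < q i) (hs : HasSum q 1) (i : ℕ+) :
    0 ≤ -Real.logb 2 (q i) :=
  neg_nonneg.2 (Real.logb_nonpos one_lt_two (hq i).le (le_hasSum hs i fun j _ => (hq j).le))

/-- The smoothed empirical distributions approximate every source of finite entropy in relative
entropy. -/
theorem IsMonotonicSource.exists_smoothedEmpirical {θ : ℕ+ → ℝ} (hθ : IsMonotonicSource θ)
    (hH : HasFiniteEntropy θ) {δ : ℝ} (hδ : 0 < δ) :
    ∃ d s, HasSum (fun i => θ i * -Real.logb 2 (smoothedEmpirical d i)) s ∧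
      s ≤ entropy θ + δ := by
  classical
  have hlog2 : 0 < Real.log 2 := Real.log_pos one_lt_two
  -- At most `m * M` real observations are mixed with `M` virtual ones; the dilution `log ((m + 1) /
  -- m)` must cost at most `δ / 2`.
  obtain ⟨m, hm⟩ := exists_nat_gt (2 / (δ * Real.log 2))
  have hm0 : (0 : ℝ) < m := lt_trans (by positivity) hm
  have hmδ : Real.logb 2 (((m : ℝ) + 1) / m) ≤ δ / 2 := by
    have h1 := Real.log_le_sub_one_of_pos (by positivity : (0 : ℝ) < ((m : ℝ) + 1) / m)
    rw [Real.logb, div_le_iff₀ hlog2]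
    refine h1.trans ?_
    rw [div_lt_iff₀ (by positivity)] at hm
    have : ((m : ℝ) + 1) / m - 1 = 1 / m := by field_simp; ring
    rw [this, div_le_iff₀ hm0]
    nlinarith
  set G : ℕ+ → ℝ := fun i => θ i * (Real.logb 2 (m + 1) + -Real.logb 2 (telescopingWeight i))
  have hlm : 0 ≤ Real.logb 2 ((m : ℝ) + 1) := Real.logb_nonneg one_lt_two (by linarith)
  have hu0 := neg_logb_nonneg_of_hasSum_one telescopingWeight_pos hasSum_telescopingWeight
  have hG0 : ∀ i, 0 ≤ G i := fun i =>
    mul_nonneg (hθ.nonneg i) (add_nonneg hlm (hu0 i))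
  have hG : Summable G := by
    refine Summable.of_nonneg_of_le hG0 (fun i => ?_)
      ((hθ.hasSum_one.summable.mul_right (Real.logb 2 ((m : ℝ) + 1) + 1)).add
        ((hθ.summable_mul_logb hH).mul_left 2))
    have := mul_le_mul_of_nonneg_left (neg_logb_telescopingWeight_le i) (hθ.nonneg i)
    simp only [G]
    linarith
  -- `G` bounds the cost of a letter covered by the virtual observations alone; outside `S` this
  -- totals less than `δ / 2`.
  obtain ⟨S, hS⟩ := (hG.hasSum.eventually
    (lt_mem_nhds (show ∑' i, G i - δ / 2 < ∑' i, G i by linarith))).exists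
  -- On `S` the virtual mass `M * telescopingWeight i` is at least `1`, which makes up for the floor
  -- in the counts.
  have hM : ∀ᶠ M : ℕ in atTop, 0 < M ∧ ∀ i ∈ S, 1 / telescopingWeight i ≤ M :=
    (eventually_gt_atTop 0).and ((Filter.eventually_all_finset S).2 fun i _ =>
      tendsto_natCast_atTop_atTop.eventually_ge_atTop _)
  obtain ⟨M, hMpos, hM⟩ := hM.exists
  have hMpos' : (0 : ℝ) < M := by exact_mod_cast hMpos
  set f : ℕ+ →₀ ℕ := Finsupp.onFinset S (fun i => if i ∈ S then ⌊m * M * θ i⌋₊ else 0)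
    fun i hi => by by_contra h; simp [h] at hi
  have hfsum : (f.sum fun _ c => (c : ℝ)) ≤ m * M := by
    have h1 : ∀ i, (f i : ℝ) ≤ m * M * θ i := fun i => by
      have h0 : 0 ≤ m * M * θ i := mul_nonneg (by positivity) (hθ.nonneg i)
      simp only [f, Finsupp.onFinset_apply]
      split_ifs
      · exact Nat.floor_le h0
      · simpa using h0
    calc (f.sum fun _ c => (c : ℝ)) ≤ ∑ i ∈ f.support, m * M * θ i :=
          Finset.sum_le_sum fun i _ => h1 i
      _ = m * M * ∑ i ∈ f.support, θ i := by rw [Finset.mul_sum]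
      _ ≤ m * M * 1 := mul_le_mul_of_nonneg_left
          (sum_le_hasSum _ (fun j _ => hθ.nonneg j) hθ.hasSum_one) (by positivity)
      _ = m * M := mul_one _
  set d : (ℕ+ →₀ ℕ) × ℕ+ := (f, ⟨M, hMpos⟩)
  have hqle : ∀ i, ((f i : ℝ) + M * telescopingWeight i) / (M * (m + 1)) ≤ smoothedEmpirical d i :=
    fun i => by
      have hu := telescopingWeight_pos i
      refine div_le_div_of_nonneg_left (by positivity) (smoothedEmpirical_denom_pos d) ?_
      change (f.sum fun _ c => (c : ℝ)) + M ≤ _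
      linarith
  have hq1 : ∀ i, -Real.logb 2 (smoothedEmpirical d i) ≤
      Real.logb 2 (m + 1) + -Real.logb 2 (telescopingWeight i) := fun i => by
    have hu := telescopingWeight_pos i
    have h1 : telescopingWeight i / (m + 1) ≤ smoothedEmpirical d i := by
      refine le_trans ?_ (hqle i)
      rw [div_le_div_iff₀ (by positivity) (by positivity)]
      have : (0 : ℝ) ≤ f i := Nat.cast_nonneg _
      nlinarith [mul_nonneg this (by positivity : (0 : ℝ) ≤ (m : ℝ) + 1)]
    have h2 := Real.logb_le_logb_of_le one_lt_two (by positivity) h1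
    rw [Real.logb_div hu.ne' (by positivity)] at h2
    linarith
  have hq2 : ∀ i ∈ S, 0 < θ i → -Real.logb 2 (smoothedEmpirical d i) ≤
      -Real.logb 2 (θ i) + Real.logb 2 (((m : ℝ) + 1) / m) := fun i hi hpos => by
    have hu := telescopingWeight_pos i
    have h1 : θ i / (((m : ℝ) + 1) / m) ≤ smoothedEmpirical d i := by
      refine le_trans ?_ (hqle i)
      have h3 : (f i : ℝ) = ⌊m * M * θ i⌋₊ := by simp [f, hi]
      have h4 := Nat.lt_floor_add_one (m * M * θ i)
      have h5 := hM i hi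
      rw [div_le_iff₀ hu] at h5
      rw [h3, le_div_iff₀ (by positivity)]
      have : θ i / (((m : ℝ) + 1) / m) * (M * (m + 1)) = m * M * θ i := by field_simp
      linarith
    have h2 := Real.logb_le_logb_of_le one_lt_two (by positivity) h1
    rw [Real.logb_div hpos.ne' (by positivity)] at h2
    linarith
  have hmm : 0 ≤ Real.logb 2 (((m : ℝ) + 1) / m) :=
    Real.logb_nonneg one_lt_two (by rw [le_div_iff₀ hm0]; linarith)
  have hent : HasSum (entropyTerm θ) (entropy θ) := Summable.hasSum hH
  have hSG : HasSum (fun i => if i ∈ S then G i else 0) (∑ i ∈ S, G i) := by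
    have : HasSum (fun i => if i ∈ S then G i else 0) (∑ i ∈ S, if i ∈ S then G i else 0) :=
      hasSum_sum_of_ne_finset_zero fun i hi => if_neg hi
    simpa [Finset.sum_ite_mem] using this
  have hR := (hent.add (hθ.hasSum_one.mul_right (Real.logb 2 (((m : ℝ) + 1) / m)))).add
    (hG.hasSum.sub hSG)
  have hle : ∀ i, θ i * -Real.logb 2 (smoothedEmpirical d i) ≤
      entropyTerm θ i + θ i * Real.logb 2 (((m : ℝ) + 1) / m) +
        (G i - if i ∈ S then G i else 0) := fun i => by
    have he : 0 ≤ θ i * -Real.logb 2 (θ i) := mul_nonneg (hθ.nonneg i) (hθ.neg_logb_nonneg i)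
    rw [entropyTerm, ← mul_neg]
    by_cases hi : i ∈ S
    · rw [if_pos hi, sub_self, add_zero, ← mul_add]
      rcases (hθ.nonneg i).eq_or_lt with h | h
      · simp [← h]
      · exact mul_le_mul_of_nonneg_left (hq2 i hi h) h.le
    · rw [if_neg hi, sub_zero]
      have h1 := mul_le_mul_of_nonneg_left (hq1 i) (hθ.nonneg i)
      have h2 := mul_nonneg (hθ.nonneg i) hmm
      simp only [G]
      linarith
  have hsm := Summable.of_nonneg_of_le (fun i => mul_nonneg (hθ.nonneg i)
    (neg_logb_nonneg_of_hasSum_one (smoothedEmpirical_pos d) (hasSum_smoothedEmpirical d) i))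
    hle hR.summable
  refine ⟨d, _, hsm.hasSum, (hasSum_le hle hsm.hasSum hR).trans ?_⟩
  linarith

/-! ### Power laws -/

/-- The power-law distribution with exponent `1 + γ` on the positive integers. -/
noncomputable def powerLaw (γ : ℝ) (i : ℕ+) : ℝ :=
  (∑' k : ℕ+, 1 / ((k : ℕ) : ℝ) ^ (1 + γ))⁻¹ / ((i : ℕ) : ℝ) ^ (1 + γ)

theorem summable_one_div_pnat_rpow {γ : ℝ} (hγ : 0 < γ) :
    Summable fun k : ℕ+ => 1 / ((k : ℕ) : ℝ) ^ (1 + γ) :=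
  (Real.summable_one_div_nat_rpow.2 (by linarith)).comp_injective PNat.coe_injective

theorem pnat_rpow_pos (k : ℕ+) (s : ℝ) : 0 < ((k : ℕ) : ℝ) ^ s :=
  Real.rpow_pos_of_pos (by exact_mod_cast k.pos) s

theorem tsum_one_div_pnat_rpow_pos {γ : ℝ} (hγ : 0 < γ) :
    0 < ∑' k : ℕ+, 1 / ((k : ℕ) : ℝ) ^ (1 + γ) :=
  (summable_one_div_pnat_rpow hγ).tsum_pos (fun k => (one_div_pos.2 (pnat_rpow_pos k _)).le) 1
    (one_div_pos.2 (pnat_rpow_pos 1 _))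

theorem powerLaw_pos {γ : ℝ} (hγ : 0 < γ) (i : ℕ+) : 0 < powerLaw γ i :=
  div_pos (inv_pos.2 (tsum_one_div_pnat_rpow_pos hγ)) (pnat_rpow_pos i _)

theorem hasSum_powerLaw {γ : ℝ} (hγ : 0 < γ) : HasSum (powerLaw γ) 1 := by
  have h := (summable_one_div_pnat_rpow hγ).hasSum.mul_left
    (∑' k : ℕ+, 1 / ((k : ℕ) : ℝ) ^ (1 + γ))⁻¹
  rw [inv_mul_cancel₀ (tsum_one_div_pnat_rpow_pos hγ).ne'] at h
  simp only [mul_one_div] at h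
  exact h

theorem eq_powerLaw {γ a : ℝ} {θ : ℕ+ → ℝ} (hγ : 0 < γ)
    (hθa : ∀ i : ℕ+, θ i = a / ((i : ℕ) : ℝ) ^ (1 + γ)) (hs : HasSum θ 1) : θ = powerLaw γ := by
  have h := (summable_one_div_pnat_rpow hγ).hasSum.mul_left a
  simp only [mul_one_div, ← hθa] at h
  funext i
  rw [hθa, powerLaw, eq_inv_of_mul_eq_one_left (h.unique hs)]

theorem neg_logb_powerLaw {γ : ℝ} (hγ : 0 < γ) (i : ℕ+) :
    -Real.logb 2 (powerLaw γ i) = Real.logb 2 (∑' k : ℕ+, 1 / ((k : ℕ) : ℝ) ^ (1 + γ)) +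
      (1 + γ) * Real.logb 2 (i : ℕ) := by
  rw [powerLaw, Real.logb_div (inv_pos.2 (tsum_one_div_pnat_rpow_pos hγ)).ne'
    (pnat_rpow_pos i _).ne', Real.logb_inv, Real.logb_rpow_eq_mul_logb_of_pos
    (by exact_mod_cast i.pos)]
  ring

/-- The logarithm is dominated by a multiple of `i ^ (γ / 2)`, leaving a summable power. -/
theorem summable_powerLaw_mul_logb {γ : ℝ} (hγ : 0 < γ) :
    Summable fun i : ℕ+ => powerLaw γ i * Real.logb 2 (i : ℕ) := by
  have hlog2 : 0 < Real.log 2 := Real.log_pos one_lt_two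
  have hZ := tsum_one_div_pnat_rpow_pos hγ
  refine Summable.of_nonneg_of_le (fun i => mul_nonneg (powerLaw_pos hγ i).le
    (Real.logb_nonneg one_lt_two (by exact_mod_cast i.pos))) (fun i => ?_)
    ((summable_one_div_pnat_rpow (half_pos hγ)).mul_left
      ((∑' k : ℕ+, 1 / ((k : ℕ) : ℝ) ^ (1 + γ))⁻¹ / (γ / 2 * Real.log 2)))
  have hi : (0 : ℝ) < (i : ℕ) := by exact_mod_cast i.pos
  have h1 := Real.log_le_rpow_div hi.le (half_pos hγ)
  have h2 : Real.logb 2 (i : ℕ) ≤ ((i : ℕ) : ℝ) ^ (γ / 2) / (γ / 2 * Real.log 2) := by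
    rw [Real.logb, ← div_div]
    exact div_le_div_of_nonneg_right h1 hlog2.le
  refine (mul_le_mul_of_nonneg_left h2 (powerLaw_pos hγ i).le).trans (le_of_eq ?_)
  have h3 := pnat_rpow_pos i (1 + γ / 2)
  have h4 := pnat_rpow_pos i (γ / 2)
  rw [powerLaw, show 1 + γ = (1 + γ / 2) + γ / 2 by ring, Real.rpow_add hi]
  field_simp

theorem hasFiniteEntropy_powerLaw {γ : ℝ} (hγ : 0 < γ) : HasFiniteEntropy (powerLaw γ) := by
  have h := ((hasSum_powerLaw hγ).summable.mul_right
    (Real.logb 2 (∑' k : ℕ+, 1 / ((k : ℕ) : ℝ) ^ (1 + γ)))).add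
    ((summable_powerLaw_mul_logb hγ).mul_left (1 + γ))
  refine h.congr fun i => ?_
  rw [entropyTerm, ← mul_neg, neg_logb_powerLaw hγ]
  ring

/-- Rounding the exponent of a power law upwards costs at most the increment of the exponent times
the expected logarithm of a letter. -/
theorem exists_hasSum_powerLaw_le {γ γ' : ℝ} (hγ : 0 < γ) (h : γ ≤ γ') :
    ∃ s, HasSum (fun i => powerLaw γ i * -Real.logb 2 (powerLaw γ' i)) s ∧
      s - entropy (powerLaw γ) ≤
        (γ' - γ) * ∑' i : ℕ+, powerLaw γ i * Real.logb 2 (i : ℕ) := by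
  have hγ' := hγ.trans_le h
  -- The normalizing sum decreases in the exponent, so rounding up gives its logarithm a favourable
  -- sign.
  have hZ : ∑' k : ℕ+, 1 / ((k : ℕ) : ℝ) ^ (1 + γ') ≤ ∑' k : ℕ+, 1 / ((k : ℕ) : ℝ) ^ (1 + γ) :=
    (summable_one_div_pnat_rpow hγ').tsum_le_tsum (fun k =>
      one_div_le_one_div_of_le (pnat_rpow_pos k _)
        (Real.rpow_le_rpow_of_exponent_le (by exact_mod_cast k.pos) (by linarith)))
      (summable_one_div_pnat_rpow hγ)
  have hZl := Real.logb_le_logb_of_le one_lt_two (tsum_one_div_pnat_rpow_pos hγ') hZ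
  have hent : HasSum (entropyTerm (powerLaw γ)) (entropy (powerLaw γ)) :=
    Summable.hasSum (hasFiniteEntropy_powerLaw hγ)
  have hs := (hent.add ((hasSum_powerLaw hγ).mul_right
    (Real.logb 2 (∑' k : ℕ+, 1 / ((k : ℕ) : ℝ) ^ (1 + γ')) -
      Real.logb 2 (∑' k : ℕ+, 1 / ((k : ℕ) : ℝ) ^ (1 + γ))))).add
    ((summable_powerLaw_mul_logb hγ).hasSum.mul_left (γ' - γ))
  have heq : (fun i => powerLaw γ i * -Real.logb 2 (powerLaw γ' i)) = _ := funext fun i => by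
    rw [show powerLaw γ i * -Real.logb 2 (powerLaw γ' i) = entropyTerm (powerLaw γ) i +
      powerLaw γ i * (Real.logb 2 (∑' k : ℕ+, 1 / ((k : ℕ) : ℝ) ^ (1 + γ')) -
        Real.logb 2 (∑' k : ℕ+, 1 / ((k : ℕ) : ℝ) ^ (1 + γ))) +
        (γ' - γ) * (powerLaw γ i * Real.logb 2 (i : ℕ)) by
      rw [entropyTerm, ← mul_neg, neg_logb_powerLaw hγ, neg_logb_powerLaw hγ']
      ring]
  rw [← heq] at hs
  exact ⟨_, hs, by linarith⟩

/-! ### The universal code and its rates -/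

/-- The two-part code for the power laws of rational exponent, on a grid that depends on the block
length, and for the smoothed empirical distributions. -/
theorem exists_powerLaw_or_smoothedEmpirical_code : ∃ C : ∀ n, BlockCode n,
    (∀ n p x, ((C n).len x : ℝ) ≤ 3 + -Real.logb 2 (telescopingWeight p) +
      ∑ t, -Real.logb 2 (powerLaw ((p : ℕ) / ((n : ℝ) + 1)) (x t))) ∧
    (∀ d, ∃ k : ℝ, ∀ n x, ((C n).len x : ℝ) ≤
      k + ∑ t, -Real.logb 2 (smoothedEmpirical d (x t))) ∧
    ∀ n, (Summable fun x => ((2 : ℝ) ^ (C n).len x)⁻¹) ∧ ∑' x, ((2 : ℝ) ^ (C n).len x)⁻¹ ≤ 1 := by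
  obtain ⟨e, he⟩ := exists_injective_nat ((ℕ+ →₀ ℕ) × ℕ+)
  have he' : Function.Injective fun d => (e d).succPNat := Nat.succPNat_injective.comp he
  -- The denominator `n + 1` keeps the exponents positive at `n = 0` too.
  have hγ : ∀ (n : ℕ) (p : ℕ+), 0 < ((p : ℕ) : ℝ) / ((n : ℝ) + 1) := fun n p =>
    div_pos (by exact_mod_cast p.pos) (by positivity)
  have hu := hasSum_telescopingWeight.summable
  have hinl : HasSum (fun p => telescopingWeight p / 2) (1 / 2) :=
    hasSum_telescopingWeight.div_const 2
  have hinr : Summable fun d => telescopingWeight (e d).succPNat :=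
    hu.comp_injective he'
  have hinr1 : ∑' d, telescopingWeight (e d).succPNat ≤ 1 :=
    (tsum_comp_le_tsum_of_inj hu (fun p => (telescopingWeight_pos p).le) he').trans_eq
      hasSum_telescopingWeight.tsum_eq
  -- Each family gets at most half the mass. The weights of the empirical family do not depend on
  -- `n`, so its overhead is constant.
  have hw : HasSum (Sum.elim (fun p => telescopingWeight p / 2)
      fun d => telescopingWeight (e d).succPNat / 2)
      (1 / 2 + (∑' d, telescopingWeight (e d).succPNat) / 2) :=
    HasSum.sum hinl (hinr.hasSum.div_const 2)
  have h := fun n => exists_twoPartCode n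
    (Sum.elim (fun p => telescopingWeight p / 2) fun d => telescopingWeight (e d).succPNat / 2)
    (Sum.elim (fun p => powerLaw ((p : ℕ) / ((n : ℝ) + 1))) smoothedEmpirical)
    (by rintro (p | d) <;> exact half_pos (telescopingWeight_pos _))
    hw.summable (by rw [hw.tsum_eq]; linarith)
    (by
      rintro (p | d)
      exacts [powerLaw_pos (hγ n p), smoothedEmpirical_pos d])
    (by
      rintro (p | d)
      exacts [hasSum_powerLaw (hγ n p), hasSum_smoothedEmpirical d])
  choose C hC hK using h
  refine ⟨C, fun n p x => (hC n (Sum.inl p) x).trans (le_of_eq ?_), fun d => ⟨_, fun n x =>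
    (hC n (Sum.inr d) x).trans (le_of_eq (add_right_comm _ _ _))⟩, hK⟩
  simp only [Sum.elim_inl]
  rw [Real.logb_div (telescopingWeight_pos p).ne' two_ne_zero, Real.logb_self_eq_one one_lt_two]
  ring

/-- A code with bounded overhead over every smoothed empirical distribution is universal. -/
theorem isUniversalMonotonicCode_of_smoothedEmpirical (C : ∀ n, BlockCode n)
    (hC : ∀ d, ∃ k : ℝ, ∀ n x, ((C n).len x : ℝ) ≤
      k + ∑ t, -Real.logb 2 (smoothedEmpirical d (x t)))
    (hK : ∀ n, (Summable fun x => ((2 : ℝ) ^ (C n).len x)⁻¹) ∧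
      ∑' x, ((2 : ℝ) ^ (C n).len x)⁻¹ ≤ 1) : IsUniversalMonotonicCode C := by
  intro θ hθ hH
  have hup : ∀ δ : ℝ, 0 < δ → ∃ k : ℝ, ∀ n : ℕ, 0 < n →
      (C n).HasFiniteExpectedLen θ ∧ (C n).redundancy θ ≤ k / n + δ := fun δ hδ => by
    obtain ⟨d, s, hs, hle⟩ := hθ.exists_smoothedEmpirical hH hδ
    obtain ⟨k, hk⟩ := hC d
    refine ⟨k, fun n hn => ?_⟩
    obtain ⟨h1, h2⟩ := hθ.redundancy_le hn (C n) (neg_logb_nonneg_of_hasSum_one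
      (smoothedEmpirical_pos d) (hasSum_smoothedEmpirical d)) (hk n) hs
    exact ⟨h1, by linarith⟩
  have hfin : ∀ n : ℕ, 0 < n → (C n).HasFiniteExpectedLen θ := fun n hn =>
    ((hup 1 one_pos).choose_spec n hn).1
  refine ⟨(eventually_gt_atTop 0).mono hfin, tendsto_order.2 ⟨fun b hb => ?_, fun b hb => ?_⟩⟩
  · filter_upwards [eventually_gt_atTop 0] with n hn
    have hn' : (0 : ℝ) < n := by exact_mod_cast hn
    have h := hθ.mul_entropy_le hH (C n).len (hK n).1 (hK n).2 (hfin n hn)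
    rw [mul_comm, ← le_div_iff₀ hn'] at h
    refine hb.trans_le ?_
    rw [BlockCode.redundancy, BlockCode.expectedLen]
    linarith
  · obtain ⟨k, hk⟩ := hup (b / 2) (half_pos hb)
    have hlim := (tendsto_const_div_atTop_nhds_zero_nat k).eventually_lt_const (half_pos hb)
    filter_upwards [eventually_gt_atTop 0, hlim] with n hn hkn
    linarith [(hk n hn).2]

/-- On power laws the redundancy is at most `2 log n + O(1)` bits per block. -/
theorem powerLaw_redundancy_le {γ : ℝ} (hγ : 0 < γ) (hθ : IsMonotonicSource (powerLaw γ)) :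
    ∃ K : ℝ, ∀ (n : ℕ) (C : BlockCode n), 0 < n →
      (∀ p x, (C.len x : ℝ) ≤ 3 + -Real.logb 2 (telescopingWeight p) +
        ∑ t, -Real.logb 2 (powerLaw ((p : ℕ) / ((n : ℝ) + 1)) (x t))) →
      C.HasFiniteExpectedLen (powerLaw γ) ∧
        C.redundancy (powerLaw γ) ≤ (K + 2 * Real.logb 2 n) / n := by
  set E := ∑' i : ℕ+, powerLaw γ i * Real.logb 2 (i : ℕ) with hE
  have hE0 : 0 ≤ E := tsum_nonneg fun i => mul_nonneg (powerLaw_pos hγ i).le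
    (Real.logb_nonneg one_lt_two (by exact_mod_cast i.pos))
  -- The grid index is at most `(2 * γ + 1) * n`, which costs `1 + 2 log` of this; `E` pays for
  -- rounding the exponent by at most `1 / n` over `n` letters.
  refine ⟨4 + 2 * Real.logb 2 (2 * γ + 1) + E, fun n C hn hC => ?_⟩
  have hn1 : (1 : ℝ) ≤ n := by exact_mod_cast hn
  have hn0 : (0 : ℝ) < n := by linarith
  have hn2 : (0 : ℝ) < (n : ℝ) + 1 := by linarith
  have hx : 0 < γ * ((n : ℝ) + 1) := by positivity
  set p : ℕ+ := ⟨⌈γ * ((n : ℝ) + 1)⌉₊, Nat.ceil_pos.2 hx⟩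
  have hp1 : γ * ((n : ℝ) + 1) ≤ (p : ℕ) := Nat.le_ceil _
  have hp2 : ((p : ℕ) : ℝ) < γ * ((n : ℝ) + 1) + 1 := Nat.ceil_lt_add_one hx.le
  have hγ' : γ ≤ (p : ℕ) / ((n : ℝ) + 1) := by rwa [le_div_iff₀ hn2]
  have hdiff : (p : ℕ) / ((n : ℝ) + 1) - γ ≤ 1 / n := by
    have h1 : ((p : ℕ) : ℝ) / ((n : ℝ) + 1) - γ ≤ 1 / ((n : ℝ) + 1) := by
      rw [sub_le_iff_le_add, div_add' _ _ _ hn2.ne']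
      exact div_le_div_of_nonneg_right (by linarith) hn2.le
    exact h1.trans (one_div_le_one_div_of_le hn0 (by linarith))
  obtain ⟨s, hs, hle⟩ := exists_hasSum_powerLaw_le hγ hγ'
  have hpos := hγ.trans_le hγ'
  obtain ⟨h1, h2⟩ := hθ.redundancy_le hn C (neg_logb_nonneg_of_hasSum_one (powerLaw_pos hpos)
    (hasSum_powerLaw hpos)) (hC p) hs
  refine ⟨h1, h2.trans ?_⟩
  have h3 : s - entropy (powerLaw γ) ≤ E / n := by
    refine hle.trans ((mul_le_mul_of_nonneg_right hdiff hE0).trans_eq ?_)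
    rw [one_div_mul_eq_div]
  have h4 : Real.logb 2 (p : ℕ) ≤ Real.logb 2 (2 * γ + 1) + Real.logb 2 n := by
    rw [← Real.logb_mul (by positivity) hn0.ne']
    refine Real.logb_le_logb_of_le one_lt_two (by exact_mod_cast p.pos) ?_
    nlinarith
  have h5 := neg_logb_telescopingWeight_le p
  have h6 : (3 + -Real.logb 2 (telescopingWeight p)) / n ≤
      (4 + 2 * Real.logb 2 (2 * γ + 1) + 2 * Real.logb 2 n) / n :=
    div_le_div_of_nonneg_right (by linarith) hn0.le
  refine (add_le_add h6 h3).trans_eq ?_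
  rw [← add_div]
  ring

/-- Once `log n ≥ 1`, the left side is at most `(|K| + 2) log n`, and `n ^ s` outgrows any constant.
-/
theorem eventually_add_two_mul_logb_le (K : ℝ) {c s : ℝ} (hc : 0 < c) (hs : 0 < s) :
    ∀ᶠ n : ℕ in atTop, K + 2 * Real.logb 2 n ≤ c * ((n : ℝ) ^ s * Real.logb 2 n) := by
  have h := ((tendsto_rpow_atTop hs).comp tendsto_natCast_atTop_atTop).eventually_ge_atTop
    ((|K| + 2) / c)
  filter_upwards [h, eventually_ge_atTop 2] with n hn h2
  have h1 : 1 ≤ Real.logb 2 (n : ℝ) := by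
    rw [Real.le_logb_iff_rpow_le one_lt_two (by positivity), Real.rpow_one]
    exact_mod_cast h2
  rw [Function.comp, div_le_iff₀ hc] at hn
  have h3 := mul_le_mul_of_nonneg_right hn (by linarith : 0 ≤ Real.logb 2 (n : ℝ))
  have h4 := mul_le_mul_of_nonneg_left h1 (abs_nonneg K)
  linarith [le_abs_self K]

theorem mainTheorem10 :
    ∃ C : ∀ n, BlockCode n,
      IsUniversalMonotonicCode C ∧
      ∀ (γ a : ℝ) (θ : ℕ+ → ℝ), 0 < γ → (∀ i : ℕ+, θ i = a / ((i : ℕ) : ℝ) ^ (1 + γ)) →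
        IsMonotonicSource θ →
        HasFiniteEntropy θ ∧
        ∀ ε : ℝ, 0 < ε → ∀ᶠ n : ℕ in atTop,
          (C n).HasFiniteExpectedLen θ ∧
          (γ ≤ 2 →
            (C n).redundancy θ ≤
              (1 + ε) * (1 / 9) * (1 + 1 / γ) * (2 / γ + ε - 1) *
                ((n : ℝ) ^ ((1 : ℝ) / 3) * Real.logb 2 n ^ 2 / n)) ∧
          (2 < γ →
            (C n).redundancy θ ≤
              (1 + ε) * (a * ((3 + γ) / (1 + γ)) / γ + (1 - 3 / (1 + γ)) / 2) *
                ((n : ℝ) ^ (1 / (1 + γ)) * Real.logb 2 n / n)) := by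
  obtain ⟨C, hC, hC', hK⟩ := exists_powerLaw_or_smoothedEmpirical_code
  refine ⟨C, isUniversalMonotonicCode_of_smoothedEmpirical C hC' hK, ?_⟩
  intro γ a θ hγ hθa hθ
  have ha : 0 ≤ a := by simpa [hθa] using hθ.nonneg 1
  obtain rfl := eq_powerLaw hγ hθa hθ.hasSum_one
  refine ⟨hasFiniteEntropy_powerLaw hγ, fun ε hε => ?_⟩
  obtain ⟨K, hKn⟩ := powerLaw_redundancy_le hγ hθ
  -- Only the positivity of the two coefficients matters; at `γ = 2` it comes from `ε` alone.
  have hsmall : γ ≤ 2 → 0 < (1 + ε) * (1 / 9) * (1 + 1 / γ) * (2 / γ + ε - 1) := fun h => by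
    have : 1 ≤ 2 / γ := by rwa [le_div_iff₀ hγ, one_mul]
    have : 0 < 2 / γ + ε - 1 := by linarith
    positivity
  have hlarge : 2 < γ → 0 < (1 + ε) * (a * ((3 + γ) / (1 + γ)) / γ + (1 - 3 / (1 + γ)) / 2) :=
    fun h => by
      have : 3 / (1 + γ) < 1 := by rw [div_lt_one (by linarith)]; linarith
      have : 0 < 1 - 3 / (1 + γ) := by linarith
      positivity
  have hev1 : ∀ᶠ n : ℕ in atTop, γ ≤ 2 → K + 2 * Real.logb 2 n ≤
      (1 + ε) * (1 / 9) * (1 + 1 / γ) * (2 / γ + ε - 1) *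
        ((n : ℝ) ^ ((1 : ℝ) / 3) * Real.logb 2 n) := by
    by_cases h : γ ≤ 2
    · filter_upwards [eventually_add_two_mul_logb_le K (hsmall h)
        (by norm_num : (0 : ℝ) < 1 / 3)] with n hn _ using hn
    · exact Eventually.of_forall fun n h' => absurd h' h
  have hev2 : ∀ᶠ n : ℕ in atTop, 2 < γ → K + 2 * Real.logb 2 n ≤
      (1 + ε) * (a * ((3 + γ) / (1 + γ)) / γ + (1 - 3 / (1 + γ)) / 2) *
        ((n : ℝ) ^ (1 / (1 + γ)) * Real.logb 2 n) := by
    by_cases h : 2 < γ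
    · filter_upwards [eventually_add_two_mul_logb_le K (hlarge h)
        (by positivity : 0 < 1 / (1 + γ))] with n hn _ using hn
    · exact Eventually.of_forall fun n h' => absurd h' h
  filter_upwards [hev1, hev2, eventually_ge_atTop 2] with n h1 h2 hn
  have hn0 : (0 : ℝ) < n := by exact_mod_cast (by omega : 0 < n)
  obtain ⟨hfin, hred⟩ := hKn n (C n) (by omega) (hC n)
  refine ⟨hfin, fun h => hred.trans ?_, fun h => hred.trans ?_⟩
  · rw [← mul_div_assoc]
    refine div_le_div_of_nonneg_right ((h1 h).trans ?_) hn0.le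
    have hl : 1 ≤ Real.logb 2 (n : ℝ) := by
      rw [Real.le_logb_iff_rpow_le one_lt_two hn0, Real.rpow_one]
      exact_mod_cast hn
    refine mul_le_mul_of_nonneg_left (mul_le_mul_of_nonneg_left ?_ (by positivity)) (hsmall h).le
    -- One logarithm suffices for the bound; the second is slack.
    exact le_self_pow₀ hl two_ne_zero
  · rw [← mul_div_assoc]
    exact div_le_div_of_nonneg_right (h2 h) hn0.le
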